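/- Consider the two-transmitter two-receiver Avestimehr–Diggavi–Tse (ADT) deterministic network with non-negative integer parameters $n_{ij}$ (the number of signal bit levels from transmitter $i$ to receiver $j$). With $q=\max_{i,j} n_{ij}$, in each use of the network transmitter $\ell$ sends $X_\ell\in\mathbb{F}_2^q$ and the receivers obtain $$Y_1=\mathbf{G}^{q-n_{11}}X_1\oplus \mathbf{G}^{q-n_{21}}X_2,\qquad Y_2=\mathbf{G}^{q-n_{12}}X_1\oplus \mathbf{G}^{q-n_{22}}X_2,$$ where $\mathbf{G}\in\mathbb{F}_2^{q\times q}$ is the shift matrix with $[\mathbf{G}]_{ij}=1$ if $i=j+1$ and $0$ otherwise. Let $S_1^K,S_2^K\in\mathbb{F}_2^K$ be independent, each consisting of $K$ i.i.d. $\mathrm{Bern}(1/2)$ bits. A code of length $N$ consists of two arbitrary encoding functions, mapping $S_\ell^K$ to a codeword $X_\ell^N\in(\mathbb{F}_2^q)^N$ for $\ell=1,2$, and two arbitrary decoding functions, mapping $Y_\ell^N$ to an estimate of $S_1^K\oplus S_2^K$; $\lambda_\ell$ is the probability that the estimate at receiver $\ell$ differs from $S_1^K\oplus S_2^K$. A computing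 rate $R$ is achievable if there are codes of length $N=1,2,\dots$ for $K_N$ source bits per transmitter with $K_N/N\to R$ and $\lambda_1,\lambda_2\to 0$ as $N\to\infty$. The computing capacity $C_{\mathsf{comp}}$ is the supremum of the achievable computing rates. **Theorem (Symmetric Networks).** If $n:=n_{11}=n_{22}$ and $m:=n_{12}=n_{21}$, then $$C_{\mathsf{comp}}=\begin{cases}\min\left\{m,\,n,\,\tfrac23\max(m,n)\right\}, & m\neq n,\\ n, & m=n.\end{cases}$$ -/

import Mathlib

open MeasureTheory Filter Topology

/-- A two-transmitter two-receiver ADT deterministic network: `nij` is the number of signal bit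
levels from transmitter `i` to receiver `j`. -/
structure ADTNetwork where
  n11 : ℕ
  n12 : ℕ
  n21 : ℕ
  n22 : ℕ

namespace ADTNetwork

/-- The length `q = max n_{ij}` of the channel input and output vectors. -/
def q (net : ADTNetwork) : ℕ := max (max net.n11 net.n12) (max net.n21 net.n22)

/-- Channel input and output vectors, in `𝔽₂^q`. -/
abbrev Signal (net : ADTNetwork) : Type := Fin net.q → ZMod 2

/-- The `q × q` shift matrix over `𝔽₂`, with entry `1` at `(i, j)` exactly when `i = j + 1`. -/
def shift (q : ℕ) : Matrix (Fin q) (Fin q) (ZMod 2) :=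
  Matrix.of fun i j => if (i : ℕ) = (j : ℕ) + 1 then 1 else 0

/-- The received signal `Y₁ = G^{q - n₁₁} X₁ ⊕ G^{q - n₂₁} X₂` in one network use.
The exponents are genuine differences, since `q` is the maximum of the `nij`. -/
def output1 (net : ADTNetwork) (x₁ x₂ : net.Signal) : net.Signal :=
  (shift net.q ^ (net.q - net.n11)).mulVec x₁ + (shift net.q ^ (net.q - net.n21)).mulVec x₂

/-- The received signal `Y₂ = G^{q - n₁₂} X₁ ⊕ G^{q - n₂₂} X₂` in one network use. -/
def output2 (net : ADTNetwork) (x₁ x₂ : net.Signal) : net.Signal :=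
  (shift net.q ^ (net.q - net.n12)).mulVec x₁ + (shift net.q ^ (net.q - net.n22)).mulVec x₂

/-- A (not necessarily linear) computing code for `K` source bits per transmitter and `N` uses of
the network: an encoding function at each transmitter, which sees its own source only, and a
decoding function at each receiver, which sees its own received sequence only. -/
structure ComputingCode (net : ADTNetwork) (K N : ℕ) where
  enc1 : (Fin K → ZMod 2) → (Fin N → net.Signal)
  enc2 : (Fin K → ZMod 2) → (Fin N → net.Signal)
  dec1 : (Fin N → net.Signal) → (Fin K → ZMod 2)
  dec2 : (Fin N → net.Signal) → (Fin K → ZMod 2)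

/-- The `Bern(1/2)` distribution on `𝔽₂ = {0, 1}`. -/
noncomputable def fairBit : Measure (ZMod 2) := (PMF.uniformOfFintype (ZMod 2)).toMeasure

/-- The joint law of the sources `(S₁^K, S₂^K)`: independent, each consisting of `K` i.i.d.
`Bern(1/2)` bits. -/
noncomputable def sourceLaw (K : ℕ) : Measure ((Fin K → ZMod 2) × (Fin K → ZMod 2)) :=
  (Measure.pi fun _ : Fin K => fairBit).prod (Measure.pi fun _ : Fin K => fairBit)

namespace ComputingCode

variable {net : ADTNetwork} {K N : ℕ}

/-- The sequence received by receiver 1 when the sources are `s`. -/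
def received1 (c : ComputingCode net K N) (s : (Fin K → ZMod 2) × (Fin K → ZMod 2)) :
    Fin N → net.Signal :=
  fun t => net.output1 (c.enc1 s.1 t) (c.enc2 s.2 t)

/-- The sequence received by receiver 2 when the sources are `s`. -/
def received2 (c : ComputingCode net K N) (s : (Fin K → ZMod 2) × (Fin K → ZMod 2)) :
    Fin N → net.Signal :=
  fun t => net.output2 (c.enc1 s.1 t) (c.enc2 s.2 t)

/-- Average probability `λ₁` that receiver 1 does not recover `S₁^K ⊕ S₂^K`. -/
noncomputable def error1 (c : ComputingCode net K N) : ℝ :=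
  (sourceLaw K).real {s | c.dec1 (c.received1 s) ≠ s.1 + s.2}

/-- Average probability `λ₂` that receiver 2 does not recover `S₁^K ⊕ S₂^K`. -/
noncomputable def error2 (c : ComputingCode net K N) : ℝ :=
  (sourceLaw K).real {s | c.dec2 (c.received2 s) ≠ s.1 + s.2}

end ComputingCode

/-- `R` is an achievable computing rate: there are codes of every length `N`, for `K N` source
bits, with `K N / N → R` and with both average error probabilities tending to `0` as `N → ∞`. -/
def AchievableRate (net : ADTNetwork) (R : ℝ) : Prop :=
  ∃ (K : ℕ → ℕ) (c : ∀ N, ComputingCode net (K N) N),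
    Tendsto (fun N => (K N : ℝ) / (N : ℝ)) atTop (𝓝 R) ∧
    Tendsto (fun N => (c N).error1) atTop (𝓝 0) ∧
    Tendsto (fun N => (c N).error2) atTop (𝓝 0)

/-- `C` is the computing capacity: the least upper bound of the achievable computing rates. -/
def IsComputingCapacity (net : ADTNetwork) (C : ℝ) : Prop :=
  IsLUB {R : ℝ | net.AchievableRate R} C

/-- The symmetric network with `n₁₁ = n₂₂ = n` and `n₁₂ = n₂₁ = m`. -/
def symmetric (n m : ℕ) : ADTNetwork where
  n11 := n
  n12 := m
  n21 := m
  n22 := n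

end ADTNetwork

/-! Put `q = max m n`, `d = |m - n|`, and let `z` be the delay by one level. Up to exchanging the
receivers, these see `X₁ + z^d X₂` and `z^d X₁ + X₂`.

Converse. With the other source fixed, the sum determines the first source, which a receiver sees
only through the top levels of `X₁`; this gives the bounds `n` and `m`. For `m ≠ n` both outputs
together determine the inputs, by induction on the level. Heuristically, if `S` is the sum, `H(Y₁) +
H(Y₂) ≥ 2 H(S) + H(Y₁, Y₂ | S)`, and the last term is about `K`, so `3K ≤ 2Nq`.
`card_pow_three_le_of_decodable` is a counting version of this, on the pairs decoded correctly.

Achievability, by linear codes without error. For `m = n` uncoded transmission works. For `0 < d`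
and `q ≤ 3d` one use suffices, with the levels of the second transmitter permuted
(`exists_isExactCode_of_le`). For `3d ≤ q`, three uses carry source halves `l, r` of `q` bits each:
with a precoder `P`, the inputs are `z^d P l + P r` and `P l + z^d P r`. Each receiver gets `P a +
z^d P b + z^(2d) P c`, where `b` is the sum of one half, already aligned, and `a, c` are the two
summands of the other half. The received `3q` bits have to determine all of `a, b, c`;
`exists_isTripling` supplies such a `P`. -/

/-! ### Shifts as delays of levels -/

/-- The shift by `k` acts on a signal given by level values by delaying them by `k` levels. -/
lemma shift_pow_mulVec (q k : ℕ) (f : ℕ → ZMod 2) :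
    (ADTNetwork.shift q ^ k).mulVec (fun i : Fin q => f i) =
      fun i : Fin q => if k ≤ (i : ℕ) then f (i - k) else 0 := by
  induction k generalizing f with
  | zero => simp
  | succ k ih =>
    have h1 : (ADTNetwork.shift q).mulVec (fun i : Fin q => f i) =
        fun i : Fin q => (fun j : ℕ => if 1 ≤ j then f (j - 1) else 0) i := by
      funext i
      simp only [Matrix.mulVec, dotProduct, ADTNetwork.shift, Matrix.of_apply, ite_mul, one_mul,
        zero_mul]
      split_ifs with h
      · rw [Finset.sum_eq_single (⟨i - 1, by omega⟩ : Fin q)]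
        · rw [if_pos (by simp; omega)]
        · intro j _ hj
          rw [if_neg]
          intro h'
          exact hj (Fin.ext (by simp; omega))
        · simp
      · exact Finset.sum_eq_zero fun j _ => if_neg (by omega)
    rw [pow_succ, ← Matrix.mulVec_mulVec, h1, ih fun j => if 1 ≤ j then f (j - 1) else 0]
    funext i
    by_cases h : k + 1 ≤ (i : ℕ)
    · rw [if_pos (by omega), if_pos h, if_pos (by omega), Nat.sub_sub]
    · rw [if_neg h]
      split_ifs <;> first | rfl | omega

/-- The value of a signal at a level, extended by zero. -/
def level {q : ℕ} (x : Fin q → ZMod 2) (i : ℕ) : ZMod 2 := if h : i < q then x ⟨i, h⟩ else 0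

lemma level_fin {q : ℕ} (x : Fin q → ZMod 2) (i : Fin q) : level x i = x i := by
  simp [level]

lemma shift_pow_mulVec_level {q : ℕ} (k : ℕ) (x : Fin q → ZMod 2) :
    (ADTNetwork.shift q ^ k).mulVec x =
      fun i : Fin q => if k ≤ (i : ℕ) then level x (i - k) else 0 := by
  rw [← shift_pow_mulVec q k (level x)]
  congr 1
  funext i
  exact (level_fin x i).symm

/-- The shift by `q - n` only sees the top `n` levels. -/
lemma shift_pow_mulVec_congr {q n : ℕ} (hn : n ≤ q) {x y : Fin q → ZMod 2}
    (h : ∀ i : Fin n, x (Fin.castLE hn i) = y (Fin.castLE hn i)) :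
    (ADTNetwork.shift q ^ (q - n)).mulVec x = (ADTNetwork.shift q ^ (q - n)).mulVec y := by
  rw [shift_pow_mulVec_level, shift_pow_mulVec_level]
  funext i
  split_ifs with hi
  · have h1 : (i : ℕ) - (q - n) < n := by omega
    have h2 : (i : ℕ) - (q - n) < q := by omega
    simpa [level, h2] using h ⟨_, h1⟩
  · rfl

/-- If the two cross links are delayed by at least one level, both outputs together determine
both inputs. -/
lemma eq_of_outputs_eq {q d : ℕ} (hd : d ≠ 0) {x y x' y' : Fin q → ZMod 2}
    (h1 : x + (ADTNetwork.shift q ^ d).mulVec y = x' + (ADTNetwork.shift q ^ d).mulVec y')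
    (h2 : (ADTNetwork.shift q ^ d).mulVec x + y = (ADTNetwork.shift q ^ d).mulVec x' + y') :
    x = x' := by
  simp only [shift_pow_mulVec_level] at h1 h2
  suffices h : ∀ i, level x i = level x' i ∧ level y i = level y' i by
    funext i
    rw [← level_fin x, ← level_fin x']
    exact (h i).1
  intro i
  induction i using Nat.strong_induction_on with
  | _ i ih =>
    by_cases hi : i < q
    · have e1 := congrFun h1 ⟨i, hi⟩
      have e2 := congrFun h2 ⟨i, hi⟩
      simp only [Pi.add_apply] at e1 e2
      have l : ∀ z : Fin q → ZMod 2, level z i = z ⟨i, hi⟩ := fun z => by simp [level, hi]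
      rw [l, l, l, l]
      by_cases hdi : d ≤ i
      · have := ih (i - d) (by omega)
        rw [if_pos hdi, if_pos hdi, this.2] at e1
        rw [if_pos hdi, if_pos hdi, this.1] at e2
        exact ⟨add_right_cancel e1, add_left_cancel e2⟩
      · rw [if_neg hdi, if_neg hdi] at e1 e2
        exact ⟨add_right_cancel e1, add_left_cancel e2⟩
    · simp [level, hi]

/-! ### Counting bounds for decodable sums -/

section Counting

/-- Termwise `f² ≤ M g h ≤ M ((g + h) / 2)²`, by the inequality of arithmetic and geometric means;
take roots and sum. -/
lemma sq_sum_le_of_le_mul {S : Type*} [Fintype S] {f g h : S → ℕ} {M Q : ℕ}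
    (hM : ∀ σ, f σ ≤ M) (hgh : ∀ σ, f σ ≤ g σ * h σ) (hg : ∑ σ, g σ ≤ Q) (hh : ∑ σ, h σ ≤ Q) :
    (∑ σ, f σ) ^ 2 ≤ M * Q ^ 2 := by
  have hkey : (∑ σ, (f σ : ℝ)) ≤ Real.sqrt M * Q := by
    have h1 : ∀ σ, (f σ : ℝ) ≤ Real.sqrt M * (((g σ : ℝ) + h σ) / 2) := by
      intro σ
      refine le_of_sq_le_sq ?_ (by positivity)
      rw [mul_pow, Real.sq_sqrt (by positivity), sq]
      have a1 : (f σ : ℝ) ≤ M := by exact_mod_cast hM σ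
      have a2 : (f σ : ℝ) ≤ g σ * h σ := by exact_mod_cast hgh σ
      have a3 : (f σ : ℝ) ≤ (((g σ : ℝ) + h σ) / 2) ^ 2 := by
        linarith [sq_nonneg ((g σ : ℝ) - h σ)]
      exact mul_le_mul a1 a3 (by positivity) (by positivity)
    refine (Finset.sum_le_sum fun σ _ => h1 σ).trans ?_
    rw [← Finset.mul_sum, ← Finset.sum_div, Finset.sum_add_distrib]
    have hg' : (∑ σ, (g σ : ℝ)) ≤ Q := by exact_mod_cast hg
    have hh' : (∑ σ, (h σ : ℝ)) ≤ Q := by exact_mod_cast hh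
    exact mul_le_mul_of_nonneg_left (by linarith) (by positivity)
  have h2 : (∑ σ, (f σ : ℝ)) ^ 2 ≤ (Real.sqrt M * Q) ^ 2 :=
    pow_le_pow_left₀ (by positivity) hkey 2
  rw [mul_pow, Real.sq_sqrt (by positivity)] at h2
  exact_mod_cast h2

variable {S : Type*} [Fintype S] [DecidableEq S] [AddCommGroup S]

/-- Cut-set bound: if the sum of the sources is recovered from `Y` on at least half of all pairs,
and `Y` sees the first source through `X` only, then `X` takes at least half as many values as
there are source words. -/
lemma card_le_two_mul_card_of_decodable {T U : Type*} [Fintype T] (A : Finset (S × S)) (Y : S × S → U) (X : S → T)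
    (hX : ∀ s s' t, X s = X s' → Y (s, t) = Y (s', t))
    (hA : ∀ p ∈ A, ∀ p' ∈ A, Y p = Y p' → p.1 + p.2 = p'.1 + p'.2)
    (hc : Fintype.card S ^ 2 ≤ 2 * A.card) :
    Fintype.card S ≤ 2 * Fintype.card T := by
  have hfib : ∀ t : S, (A.filter fun p => p.2 = t).card ≤ Fintype.card T := by
    intro t
    refine Finset.card_le_card_of_injOn (fun p => X p.1) (fun _ _ => Finset.mem_univ _) ?_
    rintro ⟨s, t1⟩ hs ⟨s', t2⟩ hs' h
    simp only [Finset.coe_filter, Set.mem_ofPred_eq] at hs hs' h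
    obtain ⟨hs, rfl⟩ := hs
    obtain ⟨hs', rfl⟩ := hs'
    have := hA _ hs _ hs' (hX _ _ _ h)
    simpa using this
  have hsum : A.card = ∑ t : S, (A.filter fun p => p.2 = t).card :=
    Finset.card_eq_sum_card_fiberwise fun _ _ => Finset.mem_coe.2 (Finset.mem_univ _)
  have hle : A.card ≤ Fintype.card S * Fintype.card T := by
    rw [hsum]
    calc _ ≤ ∑ _t : S, Fintype.card T := Finset.sum_le_sum fun t _ => hfib t
      _ = _ := by simp
  have hpos : 0 < Fintype.card S := Fintype.card_pos
  nlinarith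

/-- If the sum of the sources is recovered both from `Y₁` and from `Y₂` on most pairs, and `Y₁, Y₂`
together determine the input `X` of the first transmitter, then the cube of the number of source
words is at most of the order of the square of the number of outputs. -/
lemma card_pow_three_le_of_decodable {T U : Type*} [Fintype U] [DecidableEq U]
    (A : Finset (S × S)) (Y₁ Y₂ : S × S → U) (X : S → T)
    (hX : ∀ s s' t, X s = X s' → Y₁ (s, t) = Y₁ (s', t))
    (hY : ∀ p p', Y₁ p = Y₁ p' → Y₂ p = Y₂ p' → X p.1 = X p'.1)
    (hA₁ : ∀ p ∈ A, ∀ p' ∈ A, Y₁ p = Y₁ p' → p.1 + p.2 = p'.1 + p'.2)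
    (hA₂ : ∀ p ∈ A, ∀ p' ∈ A, Y₂ p = Y₂ p' → p.1 + p.2 = p'.1 + p'.2)
    (hc : 7 * Fintype.card S ^ 2 ≤ 8 * A.card) :
    Fintype.card S ^ 3 ≤ 4 * Fintype.card U ^ 2 := by
  set M := Fintype.card S with hM
  set Q := Fintype.card U with hQ
  have hpos : 0 < M := Fintype.card_pos
  -- `N s` is the set of good partners of `s`; in `G` are the `s` with more than half of all words
  -- as partners. Two members of `G` share a partner, which forces `X` to be injective on `G`.
  let N : S → Finset S := fun s => Finset.univ.filter fun t => (s, t) ∈ A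
  let G : Finset S := Finset.univ.filter fun s => M < 2 * (N s).card
  have hXinj : ∀ s ∈ G, ∀ s' ∈ G, X s = X s' → s = s' := by
    intro s hs s' hs' h
    have hs1 : M < 2 * (N s).card := (Finset.mem_filter.1 hs).2
    have hs2 : M < 2 * (N s').card := (Finset.mem_filter.1 hs').2
    have : ((N s) ∩ (N s')).Nonempty := by
      rw [← Finset.card_pos]
      have h1 := Finset.card_union_add_card_inter (N s) (N s')
      have h2 : (N s ∪ N s').card ≤ M := Finset.card_le_univ _
      omega
    obtain ⟨t, ht⟩ := this
    simp only [N, Finset.mem_inter, Finset.mem_filter, Finset.mem_univ, true_and] at ht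
    simpa using hA₁ _ ht.1 _ ht.2 (hX s s' t h)
  have hfib : ∀ s, (A.filter fun p => p.1 = s).card = (N s).card := by
    intro s
    refine Finset.card_bij' (fun p _ => p.2) (fun t _ => (s, t)) ?_ ?_ ?_ ?_
    · rintro ⟨a, b⟩ h
      simp only [Finset.mem_filter] at h
      obtain ⟨h, rfl⟩ := h
      simpa [N] using h
    · intro t h
      simpa [N] using h
    · rintro ⟨a, b⟩ h
      simp only [Finset.mem_filter] at h
      rw [h.2]
    · intro t _
      rfl
  let B : Finset (S × S) := A.filter fun p => p.1 ∈ G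
  have hsplit : B.card + (A.filter fun p => p.1 ∉ G).card = A.card :=
    Finset.card_filter_add_card_filter_not _
  have hAsum : A.card = ∑ s : S, (N s).card := by
    rw [Finset.card_eq_sum_card_fiberwise (f := Prod.fst) (t := Finset.univ)
      fun _ _ => Finset.mem_coe.2 (Finset.mem_univ _)]
    exact Finset.sum_congr rfl fun s _ => hfib s
  have hbad : 2 * (A.filter fun p => p.1 ∉ G).card ≤ Gᶜ.card * M := by
    rw [Finset.card_eq_sum_card_fiberwise (f := Prod.fst) (t := Gᶜ)
      fun p hp => by simpa using (Finset.mem_filter.1 hp).2, Finset.mul_sum,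
      ← smul_eq_mul Gᶜ.card, ← Finset.sum_const]
    refine Finset.sum_le_sum fun s hs => ?_
    have h1 : ((A.filter fun p => p.1 ∉ G).filter fun p => p.1 = s).card ≤ (N s).card := by
      rw [← hfib s]
      exact Finset.card_le_card (Finset.filter_subset_filter _ (Finset.filter_subset _ _))
    have h2 : ¬ M < 2 * (N s).card := by simpa [G] using hs
    omega
  have hB : B.card ≤ G.card * M := by
    rw [Finset.card_eq_sum_card_fiberwise (f := Prod.fst) (t := G)
      fun p hp => by simpa using (Finset.mem_filter.1 hp).2,
      ← smul_eq_mul G.card, ← Finset.sum_const]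
    refine Finset.sum_le_sum fun s _ => ?_
    calc _ ≤ (A.filter fun p => p.1 = s).card :=
          Finset.card_le_card (Finset.filter_subset_filter _ (Finset.filter_subset _ _))
      _ = (N s).card := hfib s
      _ ≤ M := Finset.card_le_univ _
  have hGc : G.card + Gᶜ.card = M := Finset.card_add_card_compl G
  -- `hB` and `hbad` give `7M²/8 ≤ |A| ≤ M² - |Gᶜ| M / 2`, so at most `M²/8` good pairs lie outside
  -- `B`.
  have hBlarge : M ^ 2 ≤ 2 * B.card := by nlinarith
  let F : S → Finset (S × S) := fun σ => B.filter fun p => p.1 + p.2 = σ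
  have hFM : ∀ σ, (F σ).card ≤ M := by
    intro σ
    refine Finset.card_le_card_of_injOn (t := Finset.univ) Prod.fst
      (fun _ _ => Finset.mem_coe.2 (Finset.mem_univ _)) ?_
    rintro ⟨a, b⟩ h ⟨a', b'⟩ h' hab
    simp only [F, Finset.coe_filter, Set.mem_ofPred_eq] at h h' hab
    subst hab
    have := h.2.trans h'.2.symm
    rw [add_left_cancel this]
  -- The two outputs determine `X`, hence the first source since it lies in `G`, hence the pair
  -- since its sum is `σ`.
  have hFY : ∀ σ, (F σ).card ≤ ((F σ).image Y₁).card * ((F σ).image Y₂).card := by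
    intro σ
    rw [← Finset.card_product]
    refine Finset.card_le_card_of_injOn (fun p => (Y₁ p, Y₂ p)) ?_ ?_
    · intro p hp
      exact Finset.mem_coe.2 (Finset.mem_product.2
        ⟨Finset.mem_image_of_mem _ hp, Finset.mem_image_of_mem _ hp⟩)
    · rintro ⟨a, b⟩ h ⟨a', b'⟩ h' hab
      simp only [F, B, Finset.coe_filter, Finset.mem_filter, Set.mem_ofPred_eq,
        Prod.mk.injEq] at h h' hab
      have : a = a' := hXinj _ h.1.2 _ h'.1.2 (hY _ _ hab.1 hab.2)
      subst this
      have := h.2.trans h'.2.symm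
      rw [add_left_cancel this]
  -- Decodability makes the images for different sums disjoint.
  have hsumY : ∀ Y : S × S → U,
      (∀ p ∈ A, ∀ p' ∈ A, Y p = Y p' → p.1 + p.2 = p'.1 + p'.2) →
      ∑ σ : S, ((F σ).image Y).card ≤ Q := by
    intro Y hYA
    rw [← Finset.card_biUnion]
    · exact Finset.card_le_univ _
    · intro σ _ τ _ hne
      rw [Function.onFun, Finset.disjoint_left]
      intro y hy hy'
      simp only [F, B, Finset.mem_image, Finset.mem_filter] at hy hy'
      obtain ⟨p, ⟨⟨hp, _⟩, rfl⟩, rfl⟩ := hy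
      obtain ⟨p', ⟨⟨hp', _⟩, rfl⟩, e⟩ := hy'
      exact hne (hYA _ hp _ hp' e.symm)
  have hBsum : B.card = ∑ σ : S, (F σ).card :=
    Finset.card_eq_sum_card_fiberwise fun _ _ => Finset.mem_coe.2 (Finset.mem_univ _)
  have hkey : B.card ^ 2 ≤ M * Q ^ 2 := by
    rw [hBsum]
    exact sq_sum_le_of_le_mul hFM hFY (hsumY Y₁ hA₁) (hsumY Y₂ hA₂)
  have h2 : (M ^ 2) ^ 2 ≤ (2 * B.card) ^ 2 := Nat.pow_le_pow_left hBlarge 2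
  refine le_of_mul_le_mul_left (a := M) ?_ hpos
  calc M * M ^ 3 = (M ^ 2) ^ 2 := by ring
    _ ≤ (2 * B.card) ^ 2 := h2
    _ = 4 * B.card ^ 2 := by ring
    _ ≤ 4 * (M * Q ^ 2) := Nat.mul_le_mul_left 4 hkey
    _ = M * (4 * Q ^ 2) := by ring

end Counting

/-! ### Converse: upper bounds on the rate -/

namespace ADTNetwork

instance : IsProbabilityMeasure fairBit := by unfold fairBit; infer_instance

instance (K : ℕ) : IsProbabilityMeasure (sourceLaw K) := by unfold sourceLaw; infer_instance

lemma fairBit_singleton (b : ZMod 2) : fairBit {b} = 2⁻¹ := by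
  rw [fairBit, PMF.toMeasure_apply_singleton _ _ (measurableSet_singleton b)]
  simp

/-- The sources are uniformly distributed. -/
lemma sourceLaw_real_coe (K : ℕ) (A : Finset ((Fin K → ZMod 2) × (Fin K → ZMod 2))) :
    (sourceLaw K).real A = A.card / 4 ^ K := by
  have h : ∀ s, (sourceLaw K).real {s} = (4 ^ K)⁻¹ := by
    rintro ⟨s, t⟩
    rw [Measure.real, sourceLaw, ← Set.singleton_prod_singleton, Measure.prod_prod,
      Measure.pi_singleton, Measure.pi_singleton]
    simp only [fairBit_singleton, Finset.prod_const, Finset.card_univ, Fintype.card_fin]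
    rw [← mul_pow, ENNReal.toReal_pow, ENNReal.toReal_mul, ENNReal.toReal_inv,
      ENNReal.toReal_ofNat, ← mul_inv, inv_pow]
    norm_num
  rw [← sum_measureReal_singleton, Finset.sum_congr rfl fun s _ => h s]
  simp [div_eq_mul_inv]

namespace ComputingCode

variable {net : ADTNetwork} {K N : ℕ}

/-- The pairs of source words for which both receivers recover the sum. -/
def goodPairs (c : ComputingCode net K N) : Finset ((Fin K → ZMod 2) × (Fin K → ZMod 2)) :=
  Finset.univ.filter fun s => c.dec1 (c.received1 s) = s.1 + s.2 ∧ c.dec2 (c.received2 s) = s.1 + s.2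

lemma seven_mul_card_sq_le (c : ComputingCode net K N) (h : c.error1 + c.error2 ≤ 1 / 8) :
    7 * Fintype.card (Fin K → ZMod 2) ^ 2 ≤ 8 * c.goodPairs.card := by
  have h1 : (sourceLaw K).real ((c.goodPairs : Set _)ᶜ) ≤ c.error1 + c.error2 := by
    refine le_trans (measureReal_mono ?_) (measureReal_union_le _ _)
    intro s hs
    simp only [goodPairs, Finset.coe_filter, Finset.mem_univ, true_and, Set.mem_compl_iff,
      Set.mem_ofPred_eq, not_and_or] at hs
    exact hs
  rw [probReal_compl_eq_one_sub (Finset.measurableSet _), sourceLaw_real_coe] at h1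
  have h2 : (7 : ℝ) * 4 ^ K ≤ 8 * c.goodPairs.card := by
    have : (7 / 8 : ℝ) ≤ c.goodPairs.card / 4 ^ K := by linarith
    rw [le_div_iff₀ (by positivity)] at this
    linarith
  have h3 : Fintype.card (Fin K → ZMod 2) ^ 2 = 4 ^ K := by
    rw [Fintype.card_fun, ZMod.card, Fintype.card_fin, ← pow_mul, mul_comm, pow_mul]
    norm_num
  rw [h3]
  exact_mod_cast h2

lemma eq_of_mem_goodPairs1 (c : ComputingCode net K N) :
    ∀ p ∈ c.goodPairs, ∀ p' ∈ c.goodPairs, c.received1 p = c.received1 p' →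
      p.1 + p.2 = p'.1 + p'.2 := by
  intro p hp p' hp' h
  rw [← (Finset.mem_filter.1 hp).2.1, ← (Finset.mem_filter.1 hp').2.1, h]

lemma eq_of_mem_goodPairs2 (c : ComputingCode net K N) :
    ∀ p ∈ c.goodPairs, ∀ p' ∈ c.goodPairs, c.received2 p = c.received2 p' →
      p.1 + p.2 = p'.1 + p'.2 := by
  intro p hp p' hp' h
  rw [← (Finset.mem_filter.1 hp).2.2, ← (Finset.mem_filter.1 hp').2.2, h]

lemma le_of_card_le {K M : ℕ} (h : 2 ^ K ≤ 2 * 2 ^ M) : K ≤ M + 1 := by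
  rw [← pow_succ'] at h
  exact (Nat.pow_le_pow_iff_right (by norm_num)).1 h

/-- Cut-set bound at receiver 1. -/
lemma le_mul_n11_add_one (c : ComputingCode net K N) (h : c.error1 + c.error2 ≤ 1 / 8) :
    K ≤ N * net.n11 + 1 := by
  have hn : net.n11 ≤ net.q := by unfold q; omega
  have := card_le_two_mul_card_of_decodable (T := Fin N × Fin net.n11 → ZMod 2) c.goodPairs
    c.received1 (fun s ti => c.enc1 s ti.1 (Fin.castLE hn ti.2)) ?_ c.eq_of_mem_goodPairs1 ?_
  · exact le_of_card_le (by simpa [Fintype.card_fun, ZMod.card] using this)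
  · intro s s' u hs
    funext t
    simp only [received1, output1]
    rw [shift_pow_mulVec_congr hn (y := c.enc1 s' t) fun i => congrFun hs (t, i)]
  · have := c.seven_mul_card_sq_le h
    omega

/-- Cut-set bound at receiver 2. -/
lemma le_mul_n12_add_one (c : ComputingCode net K N) (h : c.error1 + c.error2 ≤ 1 / 8) :
    K ≤ N * net.n12 + 1 := by
  have hn : net.n12 ≤ net.q := by unfold q; omega
  have := card_le_two_mul_card_of_decodable (T := Fin N × Fin net.n12 → ZMod 2) c.goodPairs
    c.received2 (fun s ti => c.enc1 s ti.1 (Fin.castLE hn ti.2)) ?_ c.eq_of_mem_goodPairs2 ?_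
  · exact le_of_card_le (by simpa [Fintype.card_fun, ZMod.card] using this)
  · intro s s' u hs
    funext t
    simp only [received2, output2]
    rw [shift_pow_mulVec_congr hn (y := c.enc1 s' t) fun i => congrFun hs (t, i)]
  · have := c.seven_mul_card_sq_le h
    omega

/-- If the two outputs together determine the first input, then `3 K` is at most about the total
number of received bits. -/
lemma three_mul_le (c : ComputingCode net K N) (h : c.error1 + c.error2 ≤ 1 / 8)
    (hnet : ∀ x y x' y', net.output1 x y = net.output1 x' y' →
      net.output2 x y = net.output2 x' y' → x = x') :
    3 * K ≤ 2 * (N * net.q) + 2 := by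
  have := card_pow_three_le_of_decodable c.goodPairs c.received1 c.received2 c.enc1 ?_ ?_
    c.eq_of_mem_goodPairs1 c.eq_of_mem_goodPairs2 (c.seven_mul_card_sq_le h)
  · have hK : Fintype.card (Fin K → ZMod 2) = 2 ^ K := by
      rw [Fintype.card_fun, ZMod.card, Fintype.card_fin]
    have hU : Fintype.card (Fin N → net.Signal) = 2 ^ (net.q * N) := by
      rw [Fintype.card_fun, Fintype.card_fun, ZMod.card, Fintype.card_fin, Fintype.card_fin,
        ← pow_mul]
    rw [hK, hU, show 4 = 2 ^ 2 from rfl, ← pow_mul, ← pow_mul, ← pow_add,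
      Nat.pow_le_pow_iff_right (by norm_num)] at this
    linarith
  · intro s s' u hs
    funext t
    simp only [received1, hs]
  · intro p p' h1 h2
    funext t
    exact hnet _ _ _ _ (congrFun h1 t) (congrFun h2 t)

end ComputingCode

lemma symmetric_q (n m : ℕ) : (symmetric n m).q = max m n := by
  simp only [q, symmetric]; omega

/-- The stronger links are undelayed. If these are the cross links, the two outputs exchange roles.
-/
lemma symmetric_eq_of_outputs_eq {n m : ℕ} (hmn : m ≠ n) (x y x' y' : (symmetric n m).Signal)
    (h1 : (symmetric n m).output1 x y = (symmetric n m).output1 x' y')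
    (h2 : (symmetric n m).output2 x y = (symmetric n m).output2 x' y') : x = x' := by
  have hq := symmetric_q n m
  have e11 : (symmetric n m).n11 = n := rfl
  have e12 : (symmetric n m).n12 = m := rfl
  have e21 : (symmetric n m).n21 = m := rfl
  have e22 : (symmetric n m).n22 = n := rfl
  simp only [output1, output2, e11, e12, e21, e22] at h1 h2
  rcases lt_or_gt_of_ne hmn with h | h
  · have h0 : (symmetric n m).q - n = 0 := by omega
    simp only [h0, pow_zero, Matrix.one_mulVec] at h1 h2
    exact eq_of_outputs_eq (by omega) h1 h2
  · have h0 : (symmetric n m).q - m = 0 := by omega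
    simp only [h0, pow_zero, Matrix.one_mulVec] at h1 h2
    exact eq_of_outputs_eq (by omega) h2 h1

/-- The additive constant `b` disappears after division by `N`, so an error bounded by a constant is
enough for the converse. -/
lemma AchievableRate.le_of_forall {net : ADTNetwork} {R a b : ℝ} (hR : net.AchievableRate R)
    (h : ∀ K N (c : ComputingCode net K N), c.error1 + c.error2 ≤ 1 / 8 → (K : ℝ) ≤ N * a + b) :
    R ≤ a := by
  obtain ⟨K, c, hK, h1, h2⟩ := hR
  have hlim : Tendsto (fun N : ℕ => a + b / (N : ℝ)) atTop (𝓝 a) := by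
    simpa using tendsto_const_nhds.add (tendsto_const_div_atTop_nhds_zero_nat b)
  refine le_of_tendsto_of_tendsto hK hlim ?_
  have h3 := h1.add h2
  rw [add_zero] at h3
  filter_upwards [h3.eventually_le_const (show (0 : ℝ) < 1 / 8 by norm_num),
    eventually_gt_atTop 0] with N hN hpos
  have hpos' : (0 : ℝ) < N := by exact_mod_cast hpos
  have := h _ _ (c N) hN
  rw [div_le_iff₀ hpos', add_mul, div_mul_cancel₀ _ hpos'.ne']
  linarith

lemma AchievableRate.le_n11 {net : ADTNetwork} {R : ℝ} (hR : net.AchievableRate R) :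
    R ≤ net.n11 :=
  hR.le_of_forall (b := 1) fun _ _ c h => by exact_mod_cast c.le_mul_n11_add_one h

lemma AchievableRate.le_n12 {net : ADTNetwork} {R : ℝ} (hR : net.AchievableRate R) :
    R ≤ net.n12 :=
  hR.le_of_forall (b := 1) fun _ _ c h => by exact_mod_cast c.le_mul_n12_add_one h

lemma AchievableRate.le_two_thirds {n m : ℕ} (hmn : m ≠ n) {R : ℝ}
    (hR : (symmetric n m).AchievableRate R) : R ≤ 2 / 3 * max (m : ℝ) (n : ℝ) := by
  refine hR.le_of_forall (b := 2 / 3) fun K N c h => ?_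
  have := c.three_mul_le h (symmetric_eq_of_outputs_eq hmn)
  rw [symmetric_q] at this
  have h' : (3 : ℝ) * K ≤ 2 * (N * max (m : ℝ) (n : ℝ)) + 2 := by exact_mod_cast this
  linarith

end ADTNetwork

/-! ### Precoders resolving three mutually delayed signals -/

/-- The signal `f` delayed by `d` levels. -/
def delay {E : Type*} [Zero E] (d : ℕ) (f : ℕ → E) (i : ℕ) : E := if d ≤ i then f (i - d) else 0

lemma delay_add {E : Type*} [AddZeroClass E] (d : ℕ) (f g : ℕ → E) :
    delay d (fun i => f i + g i) = fun i => delay d f i + delay d g i := by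
  funext i
  simp only [delay]
  split_ifs <;> simp

lemma delay_delay {E : Type*} [Zero E] (d e : ℕ) (f : ℕ → E) :
    delay d (delay e f) = delay (d + e) f := by
  funext i
  simp only [delay]
  by_cases h : d + e ≤ i
  · rw [if_pos (by omega), if_pos (by omega), if_pos h, Nat.sub_sub]
  · rw [if_neg h]
    split_ifs <;> first | rfl | omega

/-- `P` is additive and `P a + z^d P b + z^(2d) P c`, where `z` is the delay by one level, determines
the first `n` entries of each of `a`, `b`, `c` from its first `n` levels. -/
structure IsTripling (n d : ℕ) (P : (ℕ → ZMod 2) → ℕ → Fin 3 → ZMod 2) : Prop where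
  map_add : ∀ x y i, P (fun j => x j + y j) i = P x i + P y i
  eq_zero : ∀ a b c, (∀ i < n, P a i + delay d (P b) i + delay (2 * d) (P c) i = 0) →
    ∀ i < n, a i = 0 ∧ b i = 0 ∧ c i = 0

lemma exists_isTripling_three : ∃ P, IsTripling 3 1 P := by
  refine ⟨fun x i => if i = 0 then ![x 0, x 1, x 2] else 0, ?_, ?_⟩
  · intro x y i
    dsimp only
    split_ifs <;> simp
  · intro a b c h
    have h0 := h 0 (by norm_num)
    have h1 := h 1 (by norm_num)
    have h2 := h 2 (by norm_num)
    simp [delay, funext_iff, Fin.forall_fin_succ] at h0 h1 h2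
    intro i hi
    interval_cases i <;> simp_all

/-- Entry 3 is sent at levels 1, 2, 3 in uses 0, 1, 2 respectively. At received level 3 the copies
from `a`, `b`, `c` thus fall in uses 2, 1, 0, and once known they can be removed from levels 1 and
2. -/
lemma exists_isTripling_four : ∃ P, IsTripling 4 1 P := by
  refine ⟨fun x i => if i = 0 then ![x 0, x 1, x 2] else if i = 1 then ![x 3, 0, 0] else
    if i = 2 then ![0, x 3, 0] else if i = 3 then ![0, 0, x 3] else 0, ?_, ?_⟩
  · intro x y i
    dsimp only
    split_ifs <;> simp
  · intro a b c h
    have h0 := h 0 (by norm_num)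
    have h1 := h 1 (by norm_num)
    have h2 := h 2 (by norm_num)
    have h3 := h 3 (by norm_num)
    simp [delay, funext_iff, Fin.forall_fin_succ] at h0 h1 h2 h3
    intro i hi
    interval_cases i <;> simp_all

/-- Received level 3 shows `b 4`, `a 3`, `b 3` in the three uses, and level 4 shows `c 4`, `a 4 + b
3`, `c 3`. This resolves entries 3 and 4, whose contribution to level 2 can then be removed. -/
lemma exists_isTripling_five : ∃ P, IsTripling 5 1 P := by
  refine ⟨fun x i => if i = 0 then ![x 0, x 1, x 2] else
    if i = 2 then ![x 4, 0, x 3] else if i = 3 then ![0, x 3, 0] else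
    if i = 4 then ![0, x 4, 0] else 0, ?_, ?_⟩
  · intro x y i
    dsimp only
    split_ifs <;> simp
  · intro a b c h
    have h0 := h 0 (by norm_num)
    have h1 := h 1 (by norm_num)
    have h2 := h 2 (by norm_num)
    have h3 := h 3 (by norm_num)
    have h4 := h 4 (by norm_num)
    simp [delay, funext_iff, Fin.forall_fin_succ] at h0 h1 h2 h3 h4
    intro i hi
    interval_cases i <;> simp_all

/-- Level 0 carries three entries, one per use, and levels 1 and 2 stay empty to make room for the
two delayed copies. From level 3 on only `P` is seen. -/
lemma IsTripling.exists_add_three {n : ℕ} {P : (ℕ → ZMod 2) → ℕ → Fin 3 → ZMod 2}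
    (hP : IsTripling n 1 P) : ∃ P', IsTripling (n + 3) 1 P' := by
  refine ⟨fun x i => if i = 0 then ![x 0, x 1, x 2] else
    if 3 ≤ i then P (fun j => x (j + 3)) (i - 3) else 0, ?_, ?_⟩
  · intro x y i
    dsimp only
    split_ifs
    · simp
    · exact hP.map_add _ _ _
    · simp
  · intro a b c h
    have h0 := h 0 (by omega)
    have h1 := h 1 (by omega)
    have h2 := h 2 (by omega)
    simp [delay, funext_iff, Fin.forall_fin_succ] at h0 h1 h2
    have ha : ![a 0, a 1, a 2] = 0 := by
      funext i; fin_cases i <;> simp_all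
    have hb : ![b 0, b 1, b 2] = 0 := by
      funext i; fin_cases i <;> simp_all
    have hc : ![c 0, c 1, c 2] = 0 := by
      funext i; fin_cases i <;> simp_all
    have hrec := hP.eq_zero (fun j => a (j + 3)) (fun j => b (j + 3)) (fun j => c (j + 3)) ?_
    · intro i hi
      by_cases h3 : 3 ≤ i
      · have := hrec (i - 3) (by omega)
        rwa [Nat.sub_add_cancel h3] at this
      · have : i < 3 := by omega
        interval_cases i <;> simp_all
    · intro i hi
      have := h (i + 3) (by omega)
      rw [ha, hb, hc] at this
      have hshift : ∀ k ≤ 2, ∀ F : ℕ → Fin 3 → ZMod 2,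
          delay k (fun i => if i = 0 then 0 else if 3 ≤ i then F (i - 3) else 0) (i + 3) =
            delay k F i := by
        intro k hk F
        simp only [delay]
        by_cases h : k ≤ i
        · rw [if_pos (by omega), if_neg (by omega), if_pos (by omega), if_pos h,
            show i + 3 - k - 3 = i - k by omega]
        · rw [if_pos (by omega), if_neg h]
          split_ifs <;> first | rfl | omega
      rw [if_neg (by omega), if_pos (by omega), Nat.add_sub_cancel, hshift 1 (by omega),
        hshift (2 * 1) (by omega)] at this
      exact this

lemma exists_isTripling_one {n : ℕ} (hn : 3 ≤ n) : ∃ P, IsTripling n 1 P := by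
  induction n using Nat.strong_induction_on with
  | _ n ih =>
    by_cases h : n < 6
    · interval_cases n
      exacts [exists_isTripling_three, exists_isTripling_four, exists_isTripling_five]
    · obtain ⟨P, hP⟩ := ih (n - 3) (by omega) (by omega)
      obtain ⟨P', hP'⟩ := hP.exists_add_three
      exact ⟨P', by rwa [Nat.sub_add_cancel (by omega)] at hP'⟩

/-- Levels in the same residue class modulo `d` form a network with delay one. -/
lemma exists_isTripling {n d : ℕ} (hd : 0 < d) (hn : 3 * d ≤ n) : ∃ P, IsTripling n d P := by
  -- The number of levels below `n` congruent to `j` modulo `d`; it is at least 3 because `2 * d + j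
  -- < 3 * d ≤ n`.
  let len : ℕ → ℕ := fun j => (n - 1 - j) / d + 1
  have hlen : ∀ j < d, ∀ t, t < len j ↔ t * d + j < n := by
    intro j hj t
    simp only [len]
    rw [Nat.lt_succ_iff, Nat.le_div_iff_mul_le hd]
    omega
  have h3 : ∀ j : Fin d, 3 ≤ len j := by
    intro j
    have := (hlen j j.2 2).2 (by have := j.2; omega)
    omega
  choose P hP using fun j : Fin d => exists_isTripling_one (h3 j)
  let r : ℕ → Fin d := fun i => ⟨i % d, Nat.mod_lt _ hd⟩
  refine ⟨fun x i => P (r i) (fun t => x (t * d + r i)) (i / d), ?_, ?_⟩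
  · intro x y i
    exact (hP (r i)).map_add _ _ _
  · intro a b c h i hi
    have key := (hP (r i)).eq_zero (fun t => a (t * d + r i)) (fun t => b (t * d + r i))
      (fun t => c (t * d + r i)) ?_ (i / d) ?_
    · simpa [r, Nat.div_add_mod'] using key
    · intro t ht
      have hmod : ∀ s, (s * d + i % d) % d = i % d := by
        intro s
        rw [Nat.add_comm, Nat.add_mul_mod_self_right, Nat.mod_mod]
      have hdiv : ∀ s, (s * d + i % d) / d = s := by
        intro s
        rw [Nat.add_comm, Nat.add_mul_div_right _ _ hd, Nat.div_eq_of_lt (Nat.mod_lt _ hd), zero_add]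
      have hr : ∀ s, r (s * d + i % d) = r i := fun s => Fin.ext (hmod s)
      have := h (t * d + i % d) ((hlen _ (r i).2 t).1 ht)
      have hdelay : ∀ (k : ℕ) (x : ℕ → ZMod 2),
          delay (k * d) (fun i => P (r i) (fun t => x (t * d + r i)) (i / d)) (t * d + i % d) =
          delay k (P (r i) fun t => x (t * d + r i)) t := by
        intro k x
        simp only [delay]
        by_cases hk : k ≤ t
        · have e : t * d + i % d - k * d = (t - k) * d + i % d := by
            rw [Nat.sub_mul]
            have := Nat.mul_le_mul_right d hk
            omega
          rw [if_pos (le_trans (Nat.mul_le_mul_right d hk) (Nat.le_add_right _ _)), if_pos hk, e,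
            hr, hdiv]
        · have : ¬ k * d ≤ t * d + i % d := by
            have h1 : (t + 1) * d ≤ k * d := Nat.mul_le_mul_right d (by omega)
            have := Nat.mod_lt i hd
            rw [Nat.succ_mul] at h1
            omega
          rw [if_neg hk, if_neg this]
      have hd1 := hdelay 1
      rw [one_mul] at hd1
      rw [hd1, hdelay] at this
      rw [mul_one]
      rw [← this, hr, hdiv]
    · rw [hlen _ (r i).2]
      simpa [r, Nat.div_add_mod'] using hi

/-! ### Exact codes -/

/-- Encoders over the uses `τ` of a network with `q` levels, direct links without delay and cross
links of delay `d`, for source bits `κ`, from whose outputs both receivers recover the sum of the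
sources without error. -/
structure IsExactCode {κ τ : Type*} (q d : ℕ) (e₁ e₂ : (κ → ZMod 2) → τ → ℕ → ZMod 2) : Prop where
  recover₁ : ∀ u v u' v', (∀ t, ∀ i < q, e₁ u t i + delay d (e₂ v t) i =
    e₁ u' t i + delay d (e₂ v' t) i) → u + v = u' + v'
  recover₂ : ∀ u v u' v', (∀ t, ∀ i < q, delay d (e₁ u t) i + e₂ v t i =
    delay d (e₁ u' t) i + e₂ v' t i) → u + v = u' + v'

lemma exists_isExactCode_zero (q : ℕ) :
    ∃ e₁ e₂ : (Fin q → ZMod 2) → Fin 1 → ℕ → ZMod 2, IsExactCode q 0 e₁ e₂ := by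
  refine ⟨fun u _ => level u, fun u _ => level u, ?_, ?_⟩ <;>
  · intro u v u' v' h
    funext i
    simpa [delay, level_fin] using h 0 i i.2

/-- When the delay is at least a third of the levels, each cross link can be used at full rate. -/
lemma exists_isExactCode_of_le {q d : ℕ} (hq : q ≤ 3 * d) :
    ∃ e₁ e₂ : (Fin (q - d) → ZMod 2) → Fin 1 → ℕ → ZMod 2, IsExactCode q d e₁ e₂ := by
  -- Exchanges `[0, q - 2d)` with `[d, q - d)`, which are disjoint as `q ≤ 3d`, and fixes the rest.
  -- At either receiver, each index has its two source bits either added on one level or each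
  -- received alone on a level of its own.
  let π : ℕ → ℕ := fun j => if j + d < q - d then j + d else
    if j < q - d ∧ d ≤ j then j - d else j
  have hππ : ∀ j, π (π j) = j := by
    intro j
    simp only [π]
    split_ifs <;> omega
  have key : ∀ u v u' v' : Fin (q - d) → ZMod 2,
      (∀ i < q - d, level u i + level v i = level u' i + level v' i) → u + v = u' + v' := by
    intro u v u' v' h
    funext i
    simpa [level_fin] using h i i.2
  have hlev : ∀ (u : Fin (q - d) → ZMod 2) i, q - d ≤ i → level u i = 0 := by
    intro u i hi
    simp [level, Nat.not_lt.2 hi]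
  refine ⟨fun u _ => level u, fun v _ j => level v (π j), ?_, ?_⟩
  · intro u v u' v' h
    refine key _ _ _ _ fun i hi => ?_
    have h1 := h 0
    by_cases hdi : d ≤ i
    · have := h1 i (by omega)
      have e : π (i - d) = i := by simp only [π]; split_ifs <;> omega
      simpa [delay, hdi, e] using this
    · have e1 := h1 i (by omega)
      have e2 := h1 (π i + d) (by simp only [π]; split_ifs <;> omega)
      have hb : q - d ≤ π i + d := by simp only [π]; split_ifs <;> omega
      simp only [delay, if_neg hdi, add_zero] at e1
      simp only [delay, hlev _ _ hb, zero_add, if_pos (Nat.le_add_left _ _), Nat.add_sub_cancel,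
        hππ] at e2
      rw [e1, e2]
  · intro u v u' v' h
    refine key _ _ _ _ fun i hi => ?_
    have h1 := h 0
    by_cases hdi : i + d < q - d
    · have := h1 (i + d) (by omega)
      have e : π (i + d) = i := by simp only [π]; split_ifs <;> omega
      simpa [delay, e] using this
    · have e1 := h1 (i + d) (by omega)
      have e2 := h1 (π i) (by simp only [π]; split_ifs <;> omega)
      have hb : q - d ≤ π (i + d) := by simp only [π]; split_ifs <;> omega
      have hb' : ¬ d ≤ π i := by simp only [π]; split_ifs <;> omega
      simp only [delay, hlev _ _ hb, add_zero, if_pos (Nat.le_add_left _ _),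
        Nat.add_sub_cancel] at e1
      simp only [delay, if_neg hb', zero_add, hππ] at e2
      rw [e1, e2]

/-- When the delay is at most a third of the levels, `2 q` bits are computed in three uses. -/
lemma exists_isExactCode_three {q d : ℕ} (hd : 0 < d) (hq : 3 * d ≤ q) :
    ∃ e₁ e₂ : (Fin q ⊕ Fin q → ZMod 2) → Fin 3 → ℕ → ZMod 2, IsExactCode q d e₁ e₂ := by
  obtain ⟨P, hP⟩ := exists_isTripling hd hq
  let l : (Fin q ⊕ Fin q → ZMod 2) → ℕ → ZMod 2 := fun u => level fun i => u (.inl i)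
  let r : (Fin q ⊕ Fin q → ZMod 2) → ℕ → ZMod 2 := fun u => level fun i => u (.inr i)
  have hl : ∀ (u : Fin q ⊕ Fin q → ZMod 2) (i : Fin q), l u i = u (.inl i) :=
    fun u i => level_fin _ i
  have hr : ∀ (u : Fin q ⊕ Fin q → ZMod 2) (i : Fin q), r u i = u (.inr i) :=
    fun u i => level_fin _ i
  have hadd : ∀ e (x y : ℕ → ZMod 2) i (t : Fin 3),
      delay e (P fun j => x j + y j) i t = delay e (P x) i t + delay e (P y) i t := by
    intro e x y i t
    rw [show (P fun j => x j + y j) = fun i => P x i + P y i from funext (hP.map_add x y),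
      delay_add]
    rfl
  have hadd' : ∀ (x y : ℕ → ZMod 2) i (t : Fin 3),
      P (fun j => x j + y j) i t = P x i t + P y i t := by
    intro x y i t
    rw [hP.map_add, Pi.add_apply]
  have hcoord : ∀ e (f : ℕ → Fin 3 → ZMod 2) (t : Fin 3),
      delay e (fun j => f j t) = fun i => delay e f i t := by
    intro e f t
    funext i
    simp only [delay]
    split_ifs <;> rfl
  have two : (2 : ZMod 2) = 0 := rfl
  -- Receiver 1 sees `P (r u) + z^d P (l u + l v) + z^(2d) P (r v)`, and receiver 2 sees `P (l v) +
  -- z^d P (r u + r v) + z^(2d) P (l u)`.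
  refine ⟨fun u t i => delay d (P (l u)) i t + P (r u) i t,
    fun v t i => P (l v) i t + delay d (P (r v)) i t, ?_, ?_⟩
  · intro u v u' v' h
    simp only [delay_add, hcoord, delay_delay, ← two_mul] at h
    have key := hP.eq_zero (fun j => r u j + r u' j)
      (fun j => (l u j + l v j) + (l u' j + l v' j)) (fun j => r v j + r v' j) ?_
    · funext i
      rcases i with i | i <;> have := key i i.2 <;>
        simp only [hl, hr, CharTwo.add_eq_zero] at this
      · exact this.2.1
      · exact congrArg₂ (· + ·) this.1 this.2.2
    · intro i hi
      funext t
      have := h t i hi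
      simp only [Pi.add_apply, Pi.zero_apply, hadd, hadd']
      -- In characteristic two the difference of the two received signals is their sum; the multiple
      -- of `two` corrects the signs.
      linear_combination this + two * (delay d (P (l u')) i t + P (r u') i t +
        (delay d (P (l v')) i t + delay (2 * d) (P (r v')) i t))
  · intro u v u' v' h
    simp only [delay_add, hcoord, delay_delay, ← two_mul] at h
    have key := hP.eq_zero (fun j => l v j + l v' j)
      (fun j => (r u j + r v j) + (r u' j + r v' j)) (fun j => l u j + l u' j) ?_
    · funext i
      rcases i with i | i <;> have := key i i.2 <;>
        simp only [hl, hr, CharTwo.add_eq_zero] at this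
      · exact congrArg₂ (· + ·) this.2.2 this.1
      · exact this.2.1
    · intro i hi
      funext t
      have := h t i hi
      simp only [Pi.add_apply, Pi.zero_apply, hadd, hadd']
      linear_combination this + two * (delay (2 * d) (P (l u')) i t + delay d (P (r u')) i t +
        (P (l v') i t + delay d (P (r v')) i t))

/-! ### Repetition and padding of exact codes -/

section Extension

variable {κ τ κ' τ' β : Type*} {q d : ℕ} {e₁ e₂ : (κ → ZMod 2) → τ → ℕ → ZMod 2}

/-- Independent repetition of a code. -/
lemma IsExactCode.repeat (h : IsExactCode q d e₁ e₂) :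
    IsExactCode (κ := κ × β) (τ := τ × β) q d (fun u t => e₁ (fun k => u (k, t.2)) t.1)
      (fun v t => e₂ (fun k => v (k, t.2)) t.1) := by
  constructor
  · intro u v u' v' huv
    funext ⟨k, b⟩
    exact congrFun (h.recover₁ (fun k => u (k, b)) (fun k => v (k, b)) (fun k => u' (k, b))
      (fun k => v' (k, b)) fun t i hi => huv (t, b) i hi) k
  · intro u v u' v' huv
    funext ⟨k, b⟩
    exact congrFun (h.recover₂ (fun k => u (k, b)) (fun k => v (k, b)) (fun k => u' (k, b))
      (fun k => v' (k, b)) fun t i hi => huv (t, b) i hi) k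

/-- Relabelling the source bits and leaving additional uses of the network idle. -/
lemma IsExactCode.extend (h : IsExactCode q d e₁ e₂) (f : κ ≃ κ') (g : τ ↪ τ') :
    IsExactCode (κ := κ') (τ := τ') q d
      (fun u => Function.extend g (e₁ (u ∘ f)) 0) (fun v => Function.extend g (e₂ (v ∘ f)) 0) := by
  have aux : ∀ u v u' v' : κ' → ZMod 2,
      u ∘ f + v ∘ f = u' ∘ f + v' ∘ f → u + v = u' + v' := by
    intro u v u' v' huv
    funext k
    simpa using congrFun huv (f.symm k)
  constructor
  · intro u v u' v' huv
    refine aux _ _ _ _ (h.recover₁ _ _ _ _ fun t i hi => ?_)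
    simpa [g.injective.extend_apply] using huv (g t) i hi
  · intro u v u' v' huv
    refine aux _ _ _ _ (h.recover₂ _ _ _ _ fun t i hi => ?_)
    simpa [g.injective.extend_apply] using huv (g t) i hi

end Extension

/-! ### Achievability and the capacity -/

namespace ADTNetwork

lemma exists_decoder {α β γ : Type*} [Nonempty γ] (Y : α → β) (s : α → γ)
    (h : ∀ a a', Y a = Y a' → s a = s a') : ∃ D : β → γ, ∀ a, D (Y a) = s a :=
  ⟨Function.extend Y s fun _ => Classical.arbitrary γ, fun _ =>
    Function.FactorsThrough.extend_apply (fun _ _ => h _ _) _ _⟩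

/-- Encoders with which both receivers recover the sum of the sources without error. -/
lemma exists_code_of_forall {net : ADTNetwork} {K N : ℕ}
    (e₁ e₂ : (Fin K → ZMod 2) → Fin N → net.Signal)
    (h₁ : ∀ u v u' v', (∀ t, net.output1 (e₁ u t) (e₂ v t) = net.output1 (e₁ u' t) (e₂ v' t)) →
      u + v = u' + v')
    (h₂ : ∀ u v u' v', (∀ t, net.output2 (e₁ u t) (e₂ v t) = net.output2 (e₁ u' t) (e₂ v' t)) →
      u + v = u' + v') :
    ∃ c : ComputingCode net K N, c.error1 = 0 ∧ c.error2 = 0 := by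
  obtain ⟨D₁, hD₁⟩ := exists_decoder
    (fun s : (Fin K → ZMod 2) × (Fin K → ZMod 2) => fun t => net.output1 (e₁ s.1 t) (e₂ s.2 t))
    (fun s => s.1 + s.2) fun _ _ h => h₁ _ _ _ _ (congrFun h)
  obtain ⟨D₂, hD₂⟩ := exists_decoder
    (fun s : (Fin K → ZMod 2) × (Fin K → ZMod 2) => fun t => net.output2 (e₁ s.1 t) (e₂ s.2 t))
    (fun s => s.1 + s.2) fun _ _ h => h₂ _ _ _ _ (congrFun h)
  refine ⟨⟨e₁, e₂, D₁, D₂⟩, ?_, ?_⟩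
  · rw [ComputingCode.error1]
    convert measureReal_empty (μ := sourceLaw K)
    refine Set.eq_empty_of_forall_notMem fun s hs => ?_
    rw [Set.mem_ofPred_eq] at hs
    exact hs (hD₁ s)
  · rw [ComputingCode.error2]
    convert measureReal_empty (μ := sourceLaw K)
    refine Set.eq_empty_of_forall_notMem fun s hs => ?_
    rw [Set.mem_ofPred_eq] at hs
    exact hs (hD₂ s)

lemma shift_pow_mulVec_eq_delay (q k : ℕ) (f : ℕ → ZMod 2) :
    (shift q ^ k).mulVec (fun i : Fin q => f i) = fun i : Fin q => delay k f i :=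
  shift_pow_mulVec q k f

/-- Exact codes presuppose undelayed direct links. For `n ≤ m` the cross links are the undelayed
ones, so each receiver uses the recovery property of the other. -/
lemma exists_code_of_isExactCode {n m q d K N : ℕ} (hq : q = max m n) (hd : d = max m n - min m n)
    {e₁ e₂ : (Fin K → ZMod 2) → Fin N → ℕ → ZMod 2} (h : IsExactCode q d e₁ e₂) :
    ∃ c : ComputingCode (symmetric n m) K N, c.error1 = 0 ∧ c.error2 = 0 := by
  have hq' : (symmetric n m).q = q := by rw [symmetric_q, hq]
  have e11 : (symmetric n m).n11 = n := rfl
  have e12 : (symmetric n m).n12 = m := rfl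
  have e21 : (symmetric n m).n21 = m := rfl
  have e22 : (symmetric n m).n22 = n := rfl
  have delay_zero : ∀ f : ℕ → ZMod 2, delay 0 f = f := fun f => by funext i; simp [delay]
  have swap : ∀ u v u' v' : Fin K → ZMod 2, v + u = v' + u' → u + v = u' + v' := by
    intro u v u' v' huv
    rw [add_comm u, add_comm u', huv]
  refine exists_code_of_forall (fun u t i => e₁ u t i) (fun v t i => e₂ v t i) ?_ ?_
  · intro u v u' v' huv
    simp only [output1, e11, e21, shift_pow_mulVec_eq_delay] at huv
    rcases le_total m n with hmn | hmn
    · refine h.recover₁ _ _ _ _ fun t i hi => ?_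
      have := congrFun (huv t) ⟨i, hq'.symm ▸ hi⟩
      rw [show (symmetric n m).q - n = 0 by omega, show (symmetric n m).q - m = d by omega] at this
      simpa only [delay_zero, Pi.add_apply] using this
    · refine h.recover₂ _ _ _ _ fun t i hi => ?_
      have := congrFun (huv t) ⟨i, hq'.symm ▸ hi⟩
      rw [show (symmetric n m).q - m = 0 by omega, show (symmetric n m).q - n = d by omega] at this
      simpa only [delay_zero, Pi.add_apply] using this
  · intro u v u' v' huv
    simp only [output2, e12, e22, shift_pow_mulVec_eq_delay] at huv
    rcases le_total m n with hmn | hmn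
    · refine h.recover₂ _ _ _ _ fun t i hi => ?_
      have := congrFun (huv t) ⟨i, hq'.symm ▸ hi⟩
      rw [show (symmetric n m).q - n = 0 by omega, show (symmetric n m).q - m = d by omega] at this
      simpa only [delay_zero, Pi.add_apply] using this
    · refine h.recover₁ _ _ _ _ fun t i hi => ?_
      have := congrFun (huv t) ⟨i, hq'.symm ▸ hi⟩
      rw [show (symmetric n m).q - m = 0 by omega, show (symmetric n m).q - n = d by omega] at this
      simpa only [delay_zero, Pi.add_apply] using this

lemma tendsto_mul_div_div (K : ℕ) {L : ℕ} (hL : 0 < L) :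
    Tendsto (fun N : ℕ => ((K * (N / L) : ℕ) : ℝ) / N) atTop (𝓝 (K / L)) := by
  have hL' : (0 : ℝ) < L := by exact_mod_cast hL
  have h := (tendsto_nat_floor_mul_div_atTop (R := ℝ) (a := (L : ℝ)⁻¹) (by positivity)).comp
    (tendsto_natCast_atTop_atTop (R := ℝ))
  have h' := h.const_mul (K : ℝ)
  rw [← div_eq_mul_inv] at h'
  refine h'.congr fun N => ?_
  simp only [Function.comp]
  rw [inv_mul_eq_div, Nat.floor_div_eq_div]
  push_cast
  ring

/-- An exact code for `K` bits in `L` uses achieves the rate `K / L`. -/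
lemma achievableRate_of_isExactCode {n m q d K L : ℕ} (hL : 0 < L) (hq : q = max m n)
    (hd : d = max m n - min m n) {κ : Type*} [Fintype κ] (hκ : Fintype.card κ = K)
    {e₁ e₂ : (κ → ZMod 2) → Fin L → ℕ → ZMod 2} (h : IsExactCode q d e₁ e₂) :
    (symmetric n m).AchievableRate (K / L) := by
  have hex : ∀ N : ℕ, ∃ c : ComputingCode (symmetric n m) (K * (N / L)) N,
      c.error1 = 0 ∧ c.error2 = 0 := by
    intro N
    -- The `N % L` uses left over stay idle, which does not affect the limiting rate.
    let g : Fin L × Fin (N / L) ↪ Fin N :=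
      finProdFinEquiv.toEmbedding.trans (Fin.castLEEmb (Nat.mul_div_le N L))
    let f : κ × Fin (N / L) ≃ Fin (K * (N / L)) := Fintype.equivFinOfCardEq (by simp [hκ])
    exact exists_code_of_isExactCode hq hd ((h.repeat (β := Fin (N / L))).extend f g)
  choose c hc1 hc2 using hex
  refine ⟨fun N => K * (N / L), c, tendsto_mul_div_div K hL, ?_, ?_⟩
  · simp only [hc1, tendsto_const_nhds]
  · simp only [hc2, tendsto_const_nhds]

lemma achievableRate_symmetric {n m : ℕ} (hmn : m ≠ n) :
    (symmetric n m).AchievableRate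
      (min (min (m : ℝ) (n : ℝ)) (2 / 3 * max (m : ℝ) (n : ℝ))) := by
  rw [← Nat.cast_min, ← Nat.cast_max]
  have hd : 0 < max m n - min m n := by omega
  -- The threshold `max = 3 (max - min)` is exactly where `min = 2/3 max`.
  rcases le_total (max m n) (3 * (max m n - min m n)) with h | h
  · obtain ⟨e₁, e₂, he⟩ := exists_isExactCode_of_le h
    have := achievableRate_of_isExactCode one_pos rfl rfl (Fintype.card_fin _) he
    rw [show max m n - (max m n - min m n) = min m n by omega, Nat.cast_one, div_one] at this
    rwa [min_eq_left]
    have h' : 3 * min m n ≤ 2 * max m n := by omega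
    have h'' : (3 : ℝ) * (min m n : ℕ) ≤ 2 * (max m n : ℕ) := by exact_mod_cast h'
    linarith
  · obtain ⟨e₁, e₂, he⟩ := exists_isExactCode_three hd h
    have := achievableRate_of_isExactCode (K := 2 * max m n) (by norm_num) rfl rfl
      (by simp only [Fintype.card_sum, Fintype.card_fin]; ring) he
    have h' : 2 * max m n ≤ 3 * min m n := by omega
    have h'' : (2 : ℝ) * (max m n : ℕ) ≤ 3 * (min m n : ℕ) := by exact_mod_cast h'
    rw [min_eq_right (by linarith)]
    convert this using 1
    push_cast
    ring

lemma achievableRate_symmetric_self (n : ℕ) : (symmetric n n).AchievableRate n := by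
  obtain ⟨e₁, e₂, he⟩ := exists_isExactCode_zero n
  simpa using achievableRate_of_isExactCode (n := n) (m := n) one_pos (by simp) (by simp)
    (Fintype.card_fin _) he

end ADTNetwork

theorem theorem3 (n m : ℕ) :
    (m ≠ n → (ADTNetwork.symmetric n m).IsComputingCapacity
      (min (min (m : ℝ) (n : ℝ)) (2 / 3 * max (m : ℝ) (n : ℝ)))) ∧
    (m = n → (ADTNetwork.symmetric n m).IsComputingCapacity (n : ℝ)) := by
  constructor
  · intro hmn
    exact ⟨fun R hR => le_min (le_min hR.le_n12 hR.le_n11) (hR.le_two_thirds hmn),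
      fun b hb => hb (ADTNetwork.achievableRate_symmetric hmn)⟩
  · rintro rfl
    exact ⟨fun R hR => hR.le_n11, fun b hb => hb (ADTNetwork.achievableRate_symmetric_self m)⟩
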